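/- Let $n\ge 1$ and let $\Phi=A_n$, realized in $V=\{v\in\mathbb{R}^{n+1}: v_1+\dots+v_{n+1}=0\}$ with roots $e_i-e_j$ ($i\ne j$), positive roots $\Phi^+=\{e_i-e_j: i<j\}$ and simple roots $\alpha_i=e_i-e_{i+1}$ ($1\le i\le n$). Write $\alpha^\vee=2\alpha/\langle\alpha,\alpha\rangle$, let $P=\{v\in V:\langle v,\alpha^\vee\rangle\in\mathbb{Z}\text{ for all }\alpha\in\Phi\}$ be the weight lattice, and let $\Omega=\{\omega_1,\dots,\omega_n\}$ be the set of fundamental weights, where $\langle\omega_i,\alpha_j^\vee\rangle=\delta_{ij}$. Central-firing is the relation on $P$ given by $\lambda\to\lambda+\alpha$ whenever $\lambda\in P$ and $\alpha\in\Phi^+$ satisfy $\langle\lambda,\alpha^\vee\rangle=0$. It is called confluent from $\lambda\in P$ if for all $\mu,\mu'\in P$ with $\lambda\to^*\mu$ and $\lambda\to^*\mu'$ there is $\nu\in P$ with $\mu\to^*\nu$ and $\mu'\to^*\nu$, where $\to^*$ is the reflexive, transitive closure of $\to$. **Proposition.** Let $\omega\in\Omega\cup\{0\}$. Suppose that $\omega\notin\{0,\omega_1,\omega_n\}$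 if $n$ is odd, and that $\omega\notin\{\omega_{n/2},\omega_{n/2+1}\}$ if $n$ is even. Then central-firing is not confluent from $\omega$. -/

import Mathlib

open scoped InnerProductSpace

namespace CentralFiring

/-- A binary relation is confluent from `x` if any two elements reachable from `x` by its
reflexive, transitive closure have a common successor under that closure. -/
def ConfluentFrom {X : Type*} (r : X → X → Prop) (x : X) : Prop :=
  ∀ y y' : X, Relation.ReflTransGen r x y → Relation.ReflTransGen r x y' →
    ∃ z : X, Relation.ReflTransGen r y z ∧ Relation.ReflTransGen r y' z

section General

variable {V : Type*} [NormedAddCommGroup V] [InnerProductSpace ℝ V]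

/-- The coroot `α^∨ = 2 α / ⟨α, α⟩`. -/
noncomputable def coroot (α : V) : V := (2 / ⟪α, α⟫_ℝ) • α

/-- The weight lattice of a set of roots: the vectors that pair integrally with every coroot. -/
def weightLattice (Φ : Set V) : Set V :=
  {v | ∀ α ∈ Φ, ∃ m : ℤ, ⟪v, coroot α⟫_ℝ = m}

/-- `ω` is the `i`-th fundamental weight with respect to the simple roots `Δ`:
`⟨ω, α_j^∨⟩ = δ_{ij}` for all `j`. -/
def IsFundamentalWeight {ι : Type*} [DecidableEq ι] (Δ : ι → V) (i : ι) (ω : V) : Prop :=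
  ∀ j : ι, ⟪ω, coroot (Δ j)⟫_ℝ = if i = j then 1 else 0

/-- Central-firing, a relation on the weight lattice of `Φ` with positive roots `Φpos`:
`μ` is obtained from `lam` by adding a positive root `α` with `⟨lam, α^∨⟩ = 0`. -/
def Fires (Φ Φpos : Set V) (lam μ : weightLattice Φ) : Prop :=
  ∃ α ∈ Φpos, ⟪(lam : V), coroot α⟫_ℝ = 0 ∧ (μ : V) = (lam : V) + α

end General

/-- The ambient Euclidean space of type `A_n`: the vectors of `ℝ^{n+1}` with coordinate sum `0`
(with the restricted standard inner product). -/
def SpaceA (n : ℕ) : Submodule ℝ (EuclideanSpace ℝ (Fin (n + 1))) where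
  carrier := {v | ∑ i, v i = 0}
  zero_mem' := by simp
  add_mem' := by
    intro a b ha hb
    simp only [Set.mem_ofPred_eq] at ha hb ⊢
    simp [Finset.sum_add_distrib, ha, hb]
  smul_mem' := by
    intro c a ha
    simp only [Set.mem_ofPred_eq] at ha ⊢
    simp [← Finset.mul_sum, ha]

/-- The vector `e_i - e_j`. -/
noncomputable def rootA (n : ℕ) (i j : Fin (n + 1)) : SpaceA n :=
  ⟨EuclideanSpace.single i 1 - EuclideanSpace.single j 1, by
    change ∑ k, (EuclideanSpace.single i (1 : ℝ) - EuclideanSpace.single j 1 :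
      EuclideanSpace ℝ (Fin (n + 1))) k = 0
    simp⟩

/-- The root system of type `A_n`: all `e_i - e_j` with `i ≠ j`. -/
def rootsA (n : ℕ) : Set (SpaceA n) := {α | ∃ i j, i ≠ j ∧ α = rootA n i j}

/-- The positive roots of type `A_n`: all `e_i - e_j` with `i < j`. -/
def posRootsA (n : ℕ) : Set (SpaceA n) := {α | ∃ i j, i < j ∧ α = rootA n i j}

/-- The simple roots `e_i - e_{i+1}` of type `A_n`. The index `i : Fin n` is zero-based, so that
`simpleRootA n i` is the simple root with label `i + 1`. -/
noncomputable def simpleRootA (n : ℕ) (i : Fin n) : SpaceA n := rootA n i.castSucc i.succ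

/-- `IsFundWeightA n k ω`: the vector `ω` is the fundamental weight `ω_k` of type `A_n`, with the
usual labels `1 ≤ k ≤ n`. -/
def IsFundWeightA (n k : ℕ) (ω : SpaceA n) : Prop :=
  ∃ i : Fin n, (i : ℕ) + 1 = k ∧ IsFundamentalWeight (simpleRootA n) i ω

/-- Central-firing in type `A_n`, as a relation on the weight lattice. -/
def FiresA (n : ℕ) : weightLattice (rootsA n) → weightLattice (rootsA n) → Prop :=
  Fires (rootsA n) (posRootsA n)

/-- The exceptional weights of type `A_n`: `0, ω_1, ω_n` for odd `n`, and
`ω_{n/2}, ω_{n/2+1}` for even `n`. -/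
def IsExceptionalA (n : ℕ) (ω : SpaceA n) : Prop :=
  (Odd n ∧ (ω = 0 ∨ IsFundWeightA n 1 ω ∨ IsFundWeightA n n ω)) ∨
  (Even n ∧ (IsFundWeightA n (n / 2) ω ∨ IsFundWeightA n (n / 2 + 1) ω))

/-! Sanity check: every fundamental weight exists and lies in the weight lattice. -/

theorem inner_coroot_rootA (n : ℕ) (v : SpaceA n) {i j : Fin (n + 1)} (h : i ≠ j) :
    ⟪v, coroot (rootA n i j)⟫_ℝ = v.1 i - v.1 j := by
  have h1 : ∀ w : SpaceA n, ⟪w, rootA n i j⟫_ℝ = w.1 i - w.1 j := by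
    intro w
    rw [Submodule.coe_inner]
    simp [rootA, inner_sub_right, EuclideanSpace.inner_single_right]
  have h2 : ⟪rootA n i j, rootA n i j⟫_ℝ = 2 := by
    rw [h1]
    simp [rootA, h, h.symm]
    norm_num
  rw [coroot, h2, inner_smul_right, h1]
  norm_num

theorem exists_isFundWeightA (n k : ℕ) (h1 : 1 ≤ k) (h2 : k ≤ n) :
    ∃ ω : weightLattice (rootsA n), IsFundWeightA n k ω := by
  obtain ⟨c, hc⟩ : ∃ c : ℝ, ∑ i : Fin (n + 1), ((if (i : ℕ) < k then (1 : ℝ) else 0) - c) = 0 := by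
    refine ⟨(∑ i : Fin (n + 1), (if (i : ℕ) < k then (1 : ℝ) else 0)) / (n + 1), ?_⟩
    rw [Finset.sum_sub_distrib, Finset.sum_const, Finset.card_univ, Fintype.card_fin, nsmul_eq_mul]
    push_cast
    field_simp
    ring
  let w : SpaceA n :=
    ⟨WithLp.toLp 2 fun i : Fin (n + 1) => (if (i : ℕ) < k then (1 : ℝ) else 0) - c, hc⟩
  refine ⟨⟨w, ?_⟩, ⟨k - 1, by omega⟩, by simp; omega, ?_⟩
  · rintro _ ⟨i, j, hij, rfl⟩
    refine ⟨(if (i : ℕ) < k then 1 else 0) - (if (j : ℕ) < k then 1 else 0), ?_⟩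
    rw [inner_coroot_rootA n w hij]
    push_cast
    simp [w]
  · intro j
    rw [simpleRootA, inner_coroot_rootA n w (by simp [Fin.ext_iff])]
    simp only [w, Fin.val_castSucc, Fin.val_succ, Fin.ext_iff]
    split_ifs <;> first | omega | norm_num

end CentralFiring

/-! Adding a constant to all coordinates turns a weight into integer positions of n + 1 labeled
chips, `ω_k` (with `ω_0 = 0`) into `startState n k`, and central-firing into `FireIn`. Two ways of
firing then lead to incompatible outcomes. If the last chip takes part whenever its site fires, it
stays leftmost until nothing can move (`exists_terminal_last_le`). If instead the other n chips are
stabilized first, `Gap` forces them onto n distinct sites among n + 1 consecutive ones. The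
invariant sum locates the missing site h, and `Admissible` gives h ≤ 0: the last chip, still at 0,
is not left of h, while some other chip is. By `trapped` neither ever crosses h
(`exists_last_trapped`). Finally, `mirror` exchanges k and n + 1 - k, which covers the remaining
non-exceptional weights. -/

namespace ChipFiring

open Relation

/-! Labeled chip-firing on the line: the chip `i` sits at `f i`, and when two chips `i < j` share
a site, `i` may move one step to the right while `j` moves one step to the left. -/

/-! ### Chip counts and the gap condition. -/

section Chips

variable {ι : Type*}

/-- The number of chips of `T` with position in `[x, y]`. -/
def count (T : Finset ι) (f : ι → ℤ) (x y : ℤ) : ℤ :=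
  ∑ l ∈ T, if x ≤ f l ∧ f l ≤ y then 1 else 0

/-- Between the extreme chips of `T`, every interval has at most one site more than chips. -/
def Gap (T : Finset ι) (f : ι → ℤ) : Prop :=
  ∀ x y : ℤ, (∃ i ∈ T, f i ≤ x) → (∃ i ∈ T, y ≤ f i) → y - x ≤ count T f x y

theorem count_nonneg (T : Finset ι) (f : ι → ℤ) (x y : ℤ) : 0 ≤ count T f x y :=
  Finset.sum_nonneg fun l _ => by split_ifs <;> norm_num

theorem count_add (T : Finset ι) (f : ι → ℤ) {x y z : ℤ} (h1 : x ≤ y + 1) (h2 : y ≤ z) :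
    count T f x z = count T f x y + count T f (y + 1) z := by
  unfold count
  rw [← Finset.sum_add_distrib]
  refine Finset.sum_congr rfl fun l _ => ?_
  split_ifs <;> omega

theorem Gap.sub_le {T : Finset ι} {f : ι → ℤ} (hG : Gap T f) {l l' : ι} (hl : l ∈ T)
    (hl' : l' ∈ T) : f l - f l' ≤ T.card := by
  refine (hG (f l') (f l) ⟨l', hl', le_rfl⟩ ⟨l, hl, le_rfl⟩).trans ?_
  unfold count
  rw [Finset.card_eq_sum_ones, Nat.cast_sum]
  exact Finset.sum_le_sum fun l _ => by split_ifs <;> norm_num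

/-- Every chip is within `T.card` of the mean position. -/
theorem Gap.abs_le {T : Finset ι} {f : ι → ℤ} (hG : Gap T f) {l : ι} (hl : l ∈ T) :
    |f l| ≤ (T.card : ℤ) * T.card + |∑ i ∈ T, f i| := by
  have hpos : (1 : ℤ) ≤ T.card := by exact_mod_cast Finset.card_pos.2 ⟨l, hl⟩
  have h1 : ∑ l' ∈ T, (f l - f l') ≤ T.card * T.card := by
    have := Finset.sum_le_card_nsmul T (fun l' => f l - f l') T.card fun l' hl' => hG.sub_le hl hl'
    simpa using this
  have h2 : ∑ l' ∈ T, (f l' - f l) ≤ T.card * T.card := by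
    have := Finset.sum_le_card_nsmul T (fun l' => f l' - f l) T.card fun l' hl' => hG.sub_le hl' hl
    simpa using this
  simp only [Finset.sum_sub_distrib, Finset.sum_const, nsmul_eq_mul] at h1 h2
  have h3 : |(T.card : ℤ) * f l| ≤ (T.card : ℤ) * T.card + |∑ i ∈ T, f i| := by
    rw [_root_.abs_le]
    have := le_abs_self (∑ i ∈ T, f i)
    have := neg_abs_le (∑ i ∈ T, f i)
    constructor <;> linarith
  rw [abs_mul, abs_of_nonneg (by omega : (0 : ℤ) ≤ T.card)] at h3
  nlinarith [abs_nonneg (f l)]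

theorem gap_of_mem_zero_one {T : Finset ι} {f : ι → ℤ} (hf : ∀ l, f l = 0 ∨ f l = 1) :
    Gap T f := by
  rintro x y ⟨i, hi, hix⟩ ⟨j, hj, hjy⟩
  have hnn := count_nonneg T f x y
  by_cases hxy : y - x ≤ 0
  · omega
  have h1 : 1 ≤ count T f x y := by
    unfold count
    have := Finset.single_le_sum (s := T) (a := i)
      (f := fun l => if x ≤ f l ∧ f l ≤ y then (1 : ℤ) else 0)
      (fun l _ => by split_ifs <;> norm_num) hi
    refine le_trans ?_ this
    have := hf i
    have := hf j
    rw [if_pos (by omega)]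
  have := hf i
  have := hf j
  omega

/-! ### Firing: invariance, termination, trapping. -/

variable [LinearOrder ι]

/-- The state after the chips `i` and `j` have been fired. -/
def fire (i j : ι) (f : ι → ℤ) : ι → ℤ :=
  fun l => if l = i then f l + 1 else if l = j then f l - 1 else f l

/-- Firing with chips from `T` only. -/
def FireIn (T : Finset ι) (f f' : ι → ℤ) : Prop :=
  ∃ i ∈ T, ∃ j ∈ T, i < j ∧ f i = f j ∧ f' = fire i j f

theorem sum_fire {T : Finset ι} {i j : ι} (hi : i ∈ T) (hj : j ∈ T) (hij : i < j)
    (f : ι → ℤ) (g : ℤ → ℤ) :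
    ∑ l ∈ T, g (fire i j f l) =
      ∑ l ∈ T, g (f l) + (g (f i + 1) - g (f i)) + (g (f j - 1) - g (f j)) := by
  have h : ∀ l ∈ T, g (fire i j f l) = g (f l) +
      (if l = i then g (f i + 1) - g (f i) else 0) +
      (if l = j then g (f j - 1) - g (f j) else 0) := by
    intro l _
    unfold fire
    by_cases h1 : l = i
    · subst h1
      simp [hij.ne]
    · by_cases h2 : l = j
      · subst h2
        simp [h1]
      · simp [h1, h2]
  rw [Finset.sum_congr rfl h, Finset.sum_add_distrib, Finset.sum_add_distrib,
    Finset.sum_ite_eq' T i, Finset.sum_ite_eq' T j, if_pos hi, if_pos hj]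

theorem two_le_count {T : Finset ι} {i j : ι} (hi : i ∈ T) (hj : j ∈ T) (hij : i < j)
    {f : ι → ℤ} {p : ℤ} (hfi : f i = p) (hfj : f j = p) : 2 ≤ count T f p p := by
  unfold count
  have h : ∑ l ∈ ({i, j} : Finset ι), (if p ≤ f l ∧ f l ≤ p then (1 : ℤ) else 0) = 2 := by
    rw [Finset.sum_pair hij.ne]
    simp [hfi, hfj]
  rw [← h]
  refine Finset.sum_le_sum_of_subset_of_nonneg ?_ fun l _ _ => by split_ifs <;> norm_num
  intro l hl
  simp only [Finset.mem_insert, Finset.mem_singleton] at hl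
  rcases hl with rfl | rfl <;> assumption

theorem count_fire {T : Finset ι} {i j : ι} (hi : i ∈ T) (hj : j ∈ T) (hij : i < j)
    {f : ι → ℤ} {p : ℤ} (hfi : f i = p) (hfj : f j = p) (x y : ℤ) :
    count T (fire i j f) x y = count T f x y +
      (if x ≤ p + 1 ∧ p + 1 ≤ y then 1 else 0) + (if x ≤ p - 1 ∧ p - 1 ≤ y then 1 else 0) -
      2 * (if x ≤ p ∧ p ≤ y then 1 else 0) := by
  unfold count
  rw [sum_fire hi hj hij f fun q => if x ≤ q ∧ q ≤ y then 1 else 0, hfi, hfj]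
  ring

/-- Each side of the fired site may lack one chip, but the two chips on it make up for both; if it
is an endpoint of the interval, this leaves a spare for the chip that exits. Intervals avoiding it
can only gain. -/
theorem Gap.fire {T : Finset ι} {f : ι → ℤ} (hG : Gap T f) {i j : ι} (hi : i ∈ T) (hj : j ∈ T)
    (hij : i < j) (hf : f i = f j) : Gap T (fire i j f) := by
  intro x y hx hy
  obtain ⟨p, hp⟩ : ∃ p, f i = p := ⟨_, rfl⟩
  have hpj : f j = p := hf ▸ hp
  have hc := count_fire hi hj hij hp hpj x y
  have h2 := two_le_count hi hj hij hp hpj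
  have hnn := count_nonneg T (ChipFiring.fire i j f) x y
  have hxx : (∃ l ∈ T, f l ≤ x) ∨ p = x + 1 := by
    obtain ⟨l, hl, hlx⟩ := hx
    unfold ChipFiring.fire at hlx
    split_ifs at hlx with h h'
    · exact Or.inl ⟨l, hl, by omega⟩
    · subst h'
      by_cases hq : f l ≤ x
      · exact Or.inl ⟨l, hl, hq⟩
      · exact Or.inr (by omega)
    · exact Or.inl ⟨l, hl, hlx⟩
  have hyy : (∃ l ∈ T, y ≤ f l) ∨ p = y - 1 := by
    obtain ⟨l, hl, hly⟩ := hy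
    unfold ChipFiring.fire at hly
    split_ifs at hly with h h'
    · subst h
      by_cases hq : y ≤ f l
      · exact Or.inl ⟨l, hl, hq⟩
      · exact Or.inr (by omega)
    · exact Or.inl ⟨l, hl, by omega⟩
    · exact Or.inl ⟨l, hl, hly⟩
  by_cases hxy : y ≤ x
  · omega
  push Not at hxy
  by_cases hpx : x ≤ p
  · by_cases hpy : p ≤ y
    · -- the fired site lies in the interval
      have ha : count T f x y = count T f x (p - 1) + count T f p y := by
        have := count_add T f (x := x) (y := p - 1) (z := y) (by omega) (by omega)
        rwa [sub_add_cancel] at this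
      have hb := count_add T f (x := p) (y := p) (z := y) (by omega) hpy
      have hl : p - 1 - x ≤ count T f x (p - 1) := by
        rcases hxx with h | h
        · exact hG x (p - 1) h ⟨i, hi, by omega⟩
        · have := count_nonneg T f x (p - 1)
          omega
      have hr : y - (p + 1) ≤ count T f (p + 1) y := by
        rcases hyy with h | h
        · exact hG (p + 1) y ⟨i, hi, by omega⟩ h
        · have := count_nonneg T f (p + 1) y
          omega
      have := count_nonneg T f x (p - 1)
      have := count_nonneg T f (p + 1) y
      split_ifs at hc <;> omega
    · have := hG x y (hxx.resolve_right (by omega)) ⟨i, hi, by omega⟩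
      split_ifs at hc <;> omega
  · have := hG x y ⟨i, hi, by omega⟩ (hyy.resolve_right (by omega))
    split_ifs at hc <;> omega

/-- Firing preserves the sum and raises the sum of squares by 2, while `Gap` bounds the latter. The
subrelation `r` allows a firing strategy to be prescribed. -/
theorem exists_terminal {T : Finset ι} {r : (ι → ℤ) → (ι → ℤ) → Prop}
    (hr : ∀ f f', r f f' → FireIn T f f') (f : ι → ℤ) (hG : Gap T f) :
    ∃ g, ReflTransGen r f g ∧ ∀ g', ¬ r g g' := by
  obtain ⟨s, hs⟩ : ∃ s, ∑ l ∈ T, f l = s := ⟨_, rfl⟩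
  obtain ⟨B, hB⟩ : ∃ B : ℤ, B = T.card * ((T.card : ℤ) * T.card + |s|) ^ 2 := ⟨_, rfl⟩
  obtain ⟨d, hd⟩ : ∃ d : ℕ, B - ∑ l ∈ T, f l ^ 2 ≤ d := ⟨_, Int.self_le_toNat _⟩
  induction d generalizing f with
  | zero =>
    refine ⟨f, .refl, fun g' hg' => ?_⟩
    obtain ⟨i, hi, j, hj, hij, hf, rfl⟩ := hr _ _ hg'
    have hG' := hG.fire hi hj hij hf
    have hsq := sum_fire hi hj hij f fun q => q ^ 2
    have hs' := sum_fire hi hj hij f fun q => q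
    have hs'' : ∑ l ∈ T, fire i j f l = s := by rw [hs']; omega
    have hle : ∑ l ∈ T, fire i j f l ^ 2 ≤ B := by
      have := Finset.sum_le_card_nsmul T (fun l => fire i j f l ^ 2)
        (((T.card : ℤ) * T.card + |s|) ^ 2) fun l hl => by
          have := hG'.abs_le hl
          rw [hs''] at this
          exact sq_le_sq.2 (this.trans (le_abs_self _))
      rwa [nsmul_eq_mul, ← hB] at this
    rw [hf] at hsq
    push_cast at hd
    nlinarith
  | succ d ih =>
    by_cases h : ∃ g', r f g'
    · obtain ⟨g', hg'⟩ := h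
      obtain ⟨i, hi, j, hj, hij, hf, rfl⟩ := hr _ _ hg'
      have hsq := sum_fire hi hj hij f fun q => q ^ 2
      have hs' := sum_fire hi hj hij f fun q => q
      obtain ⟨g, hg, hterm⟩ := ih (fire i j f) (hG.fire hi hj hij hf) (by rw [hs']; omega) (by
        rw [hf] at hsq
        push_cast at hd
        nlinarith)
      exact ⟨g, .head hg' hg, hterm⟩
    · exact ⟨f, .refl, fun g' hg' => h ⟨g', hg'⟩⟩

/-- Chips to the left of a free site `a` of a configuration that is thin to the right of `a`
never move, and the other chips stay at or to the right of `a`. -/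
theorem trapped [Fintype ι] {a : ℤ} {g f : ι → ℤ} (h : ReflTransGen (FireIn Finset.univ) g f)
    (hinj : ∀ i j, g i < a → g i = g j → i = j)
    (hthin : ∀ x, a ≤ x → count Finset.univ g a x ≤ x - a + 1) :
    (∀ l, g l < a → f l = g l) ∧ (∀ l, a ≤ g l → a ≤ f l) ∧
      ∀ x, a ≤ x → count Finset.univ f a x ≤ x - a + 1 := by
  induction h with
  | refl => exact ⟨fun _ _ => rfl, fun _ h => h, hthin⟩
  | @tail f f' _ hf ih =>
    obtain ⟨h1, h2, h3⟩ := ih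
    obtain ⟨i, hi, j, hj, hij, hfij, rfl⟩ := hf
    obtain ⟨p, hp⟩ : ∃ p, f i = p := ⟨_, rfl⟩
    have hpj : f j = p := hfij ▸ hp
    have hc := two_le_count hi hj hij hp hpj
    have key : a < p := by
      rcases lt_trichotomy p a with hpa | rfl | hpa
      · have hgi : g i < a := by
          by_contra hh
          have := h2 i (by omega)
          omega
        have hgj : g j < a := by
          by_contra hh
          have := h2 j (by omega)
          omega
        exact absurd (hinj i j hgi (by rw [← h1 i hgi, ← h1 j hgj, hfij])) hij.ne
      · have := h3 p le_rfl
        omega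
      · exact hpa
    refine ⟨fun l hl => ?_, fun l hl => ?_, fun x hx => ?_⟩
    · have := h1 l hl
      unfold fire
      split_ifs with hh hh'
      · subst hh; omega
      · subst hh'; omega
      · exact this
    · have := h2 l hl
      unfold fire
      split_ifs with hh hh'
      · omega
      · subst hh'; omega
      · exact this
    · rw [count_fire hi hj hij hp hpj]
      have hx3 := h3 x hx
      -- Only the interval ending at `p - 1` gains a chip; it had one to spare because `p` held two.
      by_cases hxp : x = p - 1
      · subst hxp
        have ha := count_add Finset.univ f (x := a) (y := p - 1) (z := p) (by omega) (by omega)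
        rw [sub_add_cancel] at ha
        have := h3 p key.le
        split_ifs <;> omega
      · split_ifs <;> omega

end Chips

/-! ### The two incompatible outcomes. -/

/-- A set of `n` integers spanning at most `n + 1` sites is an interval of `n + 1` sites without
one of them. -/
theorem exists_eq_Icc_erase {n : ℕ} {A : Finset ℤ} (hA : A.Nonempty) (hcard : A.card = n)
    (hspan : ∀ x ∈ A, ∀ y ∈ A, x - y ≤ n) :
    ∃ lo h : ℤ, lo ∈ A ∧ h ∉ A ∧ lo ≤ h ∧ h ≤ lo + n ∧
      2 * ∑ x ∈ A, x = (n + 1) * (2 * lo + n) - 2 * h := by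
  obtain ⟨lo, hlo⟩ : ∃ lo, A.min' hA = lo := ⟨_, rfl⟩
  have hmem : lo ∈ A := hlo ▸ A.min'_mem hA
  have hmin : ∀ x ∈ A, lo ≤ x := fun x hx => hlo ▸ A.min'_le x hx
  have hsub : A ⊆ Finset.Icc lo (lo + n) := fun x hx => by
    have := hspan x hx lo hmem
    have := hmin x hx
    rw [Finset.mem_Icc]
    omega
  have hc : (Finset.Icc lo (lo + n) \ A).card = 1 := by
    rw [Finset.card_sdiff_of_subset hsub, Int.card_Icc, hcard]
    omega
  obtain ⟨h, hh⟩ := Finset.card_eq_one.1 hc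
  have hhm : h ∈ Finset.Icc lo (lo + n) \ A := hh ▸ Finset.mem_singleton_self h
  rw [Finset.mem_sdiff, Finset.mem_Icc] at hhm
  refine ⟨lo, h, hmem, hhm.2, hhm.1.1, hhm.1.2, ?_⟩
  have hsum := Finset.sum_sdiff (f := fun x : ℤ => x) hsub
  rw [hh, Finset.sum_singleton] at hsum
  have hIcc : ∀ k : ℕ, 2 * ∑ x ∈ Finset.Icc lo (lo + k), x = (k + 1) * (2 * lo + k) := by
    intro k
    induction k with
    | zero => simp
    | succ k ih =>
      have : Finset.Icc lo (lo + (k + 1 : ℕ)) =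
          insert (lo + (k + 1 : ℕ)) (Finset.Icc lo (lo + k)) := by
        ext x
        simp only [Finset.mem_Icc, Finset.mem_insert]
        omega
      rw [this, Finset.sum_insert (by simp), mul_add, ih]
      push_cast
      ring
  have := hIcc n
  linarith

/-- The state with the first `k` chips at `1` and the others at `0`. -/
def startState (n k : ℕ) (i : Fin (n + 1)) : ℤ := if (i : ℕ) < k then 1 else 0

theorem startState_eq_zero_or_one (n k : ℕ) (i : Fin (n + 1)) :
    startState n k i = 0 ∨ startState n k i = 1 := by
  unfold startState
  split_ifs <;> simp

/-- Chips can be fired such that the last chip ends up as the leftmost one. -/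
theorem exists_terminal_last_le (n k : ℕ) (hk : k ≤ n) :
    ∃ y, ReflTransGen (FireIn Finset.univ) (startState n k) y ∧
      (∀ z, ¬ FireIn Finset.univ y z) ∧ ∀ l, y (Fin.last n) ≤ y l := by
  -- Strategy: at the site of the last chip, only pairs containing that chip fire.
  let r : (Fin (n + 1) → ℤ) → (Fin (n + 1) → ℤ) → Prop := fun f f' =>
    ∃ i j, i < j ∧ f i = f j ∧ (f (Fin.last n) = f i → j = Fin.last n) ∧ f' = fire i j f
  have hr : ∀ f f', r f f' → FireIn Finset.univ f f' := by
    rintro f f' ⟨i, j, hij, hf, -, rfl⟩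
    exact ⟨i, Finset.mem_univ _, j, Finset.mem_univ _, hij, hf, rfl⟩
  obtain ⟨y, hy, hterm⟩ :=
    exists_terminal hr _ (gap_of_mem_zero_one (startState_eq_zero_or_one n k))
  refine ⟨y, ReflTransGen.mono hr _ _ hy, ?_, ?_⟩
  · rintro z ⟨i, -, j, -, hij, hf, -⟩
    by_cases h : y (Fin.last n) = y i
    · exact hterm _ ⟨i, Fin.last n, hij.trans_le (Fin.le_last j), h.symm, fun _ => rfl, rfl⟩
    · exact hterm _ ⟨i, j, hij, hf, fun h' => absurd h' h, rfl⟩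
  · clear hterm
    induction hy with
    | refl =>
      intro l
      have : startState n k (Fin.last n) = 0 := by
        simp [startState, hk]
      rw [this]
      rcases startState_eq_zero_or_one n k l with h | h <;> rw [h]
      norm_num
    | @tail f f' _ hf ih =>
      obtain ⟨i, j, hij, hfij, hlast, rfl⟩ := hf
      intro l
      have h1 := ih l
      have h2 := ih i
      have h3 : i ≠ Fin.last n := (hij.trans_le (Fin.le_last j)).ne
      unfold fire
      by_cases hj : j = Fin.last n
      · subst hj
        rw [if_neg h3.symm, if_pos rfl]
        split_ifs with h h'
        · omega
        · subst h'; omega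
        · omega
      · have h4 : f (Fin.last n) ≠ f i := fun h => hj (hlast h)
        rw [if_neg h3.symm, if_neg (Ne.symm hj)]
        split_ifs with h h'
        · omega
        · subst h'; omega
        · omega

theorem sum_startState (n k : ℕ) (hk : k ≤ n) :
    ∑ l ∈ Finset.univ.erase (Fin.last n), startState n k l = k := by
  rw [Finset.sum_erase _ (by simp [startState, hk])]
  unfold startState
  rw [Finset.sum_boole]
  norm_cast
  rw [Fin.card_filter_val_lt]
  omega

/-- The cases in which the last chip may end up at a site that is not the leftmost one. -/
def Admissible (n k : ℕ) : Prop :=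
  ∃ m : ℕ, (n = 2 * m ∧ k < m) ∨ (n + 1 = 2 * m ∧ m ≤ k ∧ k + 2 ≤ 2 * m)

/-- With t = lo + m, the sum gives h = (2m + 1)t - k or h = m(2t - 1) - k. Small t makes h ≤ 0;
larger t pushes h beyond lo + n. -/
theorem hole_arith {n k : ℕ} (hnk : Admissible n k) {lo h : ℤ} (h1 : 1 ≤ h) (h2 : h ≤ lo + n)
    (hs : 2 * (k : ℤ) = (n + 1) * (2 * lo + n) - 2 * h) : False := by
  obtain ⟨m, ⟨rfl, hk⟩ | ⟨hn, hk, hk'⟩⟩ := hnk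
  · push_cast at *
    obtain ⟨t, rfl⟩ : ∃ t : ℤ, lo = t - m := ⟨lo + m, by ring⟩
    rcases le_or_gt t 0 with ht | ht
    · nlinarith
    · have : (m : ℤ) ≤ m * t := by nlinarith
      zify at hk
      nlinarith
  · have hn' : (n : ℤ) = 2 * m - 1 := by omega
    rw [hn'] at *
    obtain ⟨t, rfl⟩ : ∃ t : ℤ, lo = t - m := ⟨lo + m, by ring⟩
    zify at hk hk'
    rcases le_or_gt t 1 with ht | ht
    · nlinarith
    · nlinarith

/-- Chips can be fired such that the last chip cannot become the leftmost one any more. -/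
theorem exists_last_trapped (n k : ℕ) (hnk : Admissible n k) :
    ∃ y, ReflTransGen (FireIn Finset.univ) (startState n k) y ∧
      ∀ z, ReflTransGen (FireIn Finset.univ) y z → ∃ l, z l < z (Fin.last n) := by
  have hkn : k ≤ n ∧ 1 ≤ n := by
    obtain ⟨m, hm⟩ := hnk
    omega
  obtain ⟨T, hT⟩ : ∃ T, T = Finset.univ.erase (Fin.last n) := ⟨_, rfl⟩
  have hTcard : T.card = n := by simp [hT]
  have hmemT : ∀ l, l ∈ T ↔ l ≠ Fin.last n := fun l => by simp [hT]
  obtain ⟨g, hg, hterm⟩ := exists_terminal (fun _ _ h => h) _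
    (gap_of_mem_zero_one (T := T) (startState_eq_zero_or_one n k))
  have hinv : g (Fin.last n) = 0 ∧ Gap T g ∧ ∑ l ∈ T, g l = k := by
    clear hterm
    induction hg with
    | refl =>
      exact ⟨by simp [startState, hkn.1], gap_of_mem_zero_one (startState_eq_zero_or_one n k),
        hT ▸ sum_startState n k hkn.1⟩
    | tail _ hf ih =>
      obtain ⟨h1, h2, h3⟩ := ih
      obtain ⟨i, hi, j, hj, hij, hfij, rfl⟩ := hf
      refine ⟨?_, h2.fire hi hj hij hfij, ?_⟩
      · rw [fire, if_neg ((hmemT i).1 hi).symm, if_neg ((hmemT j).1 hj).symm, h1]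
      · rw [sum_fire hi hj hij _ fun q => q]
        omega
  obtain ⟨hlast, hG, hsum⟩ := hinv
  have hinj : Set.InjOn g T := by
    intro i hi j hj hij
    by_contra hne
    rcases lt_or_gt_of_ne hne with h | h
    · exact hterm _ ⟨i, hi, j, hj, h, hij, rfl⟩
    · exact hterm _ ⟨j, hj, i, hi, h, hij.symm, rfl⟩
  obtain ⟨lo, h, hlo, hh, hloh, hhlo, hs⟩ := exists_eq_Icc_erase (n := n) (A := T.image g)
    (Finset.Nonempty.image (Finset.card_pos.1 (by omega)) g)
    (by rw [Finset.card_image_of_injOn hinj, hTcard]) (by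
      intro x hx y hy
      obtain ⟨i, hi, rfl⟩ := Finset.mem_image.1 hx
      obtain ⟨j, hj, rfl⟩ := Finset.mem_image.1 hy
      have := hG.sub_le hi hj
      rwa [hTcard] at this)
  rw [Finset.sum_image hinj, hsum] at hs
  have hle : h ≤ 0 := by
    by_contra hcon
    exact hole_arith hnk (by omega) hhlo hs
  obtain ⟨l, hl, rfl⟩ := Finset.mem_image.1 hlo
  have hlh : g l < h := lt_of_le_of_ne hloh fun e => hh (e ▸ hlo)
  refine ⟨g, ReflTransGen.mono (fun _ _ ⟨i, _, j, _, hf⟩ =>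
    ⟨i, Finset.mem_univ _, j, Finset.mem_univ _, hf⟩) _ _ hg,
    fun z hz => ⟨l, ?_⟩⟩
  have htrap := trapped (a := h) hz (by
    intro i j hi hij
    refine hinj ((hmemT i).2 ?_) ((hmemT j).2 ?_) hij
    · rintro rfl; omega
    -- Right of the hole, the other chips fill at most x - h sites up to x; the last chip adds at
    -- most one.
    · rintro rfl; omega) (by
    intro x hx
    have hsub : count T g h x ≤ x - h := by
      have h1 : count T g h x = ((T.filter fun l => h ≤ g l ∧ g l ≤ x).card : ℤ) := by
        unfold count
        rw [Finset.sum_boole]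
      have h2 : ((T.filter fun l => h ≤ g l ∧ g l ≤ x).image g).card ≤
          (Finset.Icc (h + 1) x).card := by
        refine Finset.card_le_card fun q hq => ?_
        obtain ⟨l', hl', rfl⟩ := Finset.mem_image.1 hq
        rw [Finset.mem_filter] at hl'
        have : h ≠ g l' := fun e => hh (e ▸ Finset.mem_image_of_mem g hl'.1)
        rw [Finset.mem_Icc]
        omega
      rw [Finset.card_image_of_injOn (hinj.mono fun q hq => (Finset.mem_filter.1 hq).1),
        Int.card_Icc] at h2
      omega
    have hadd : count Finset.univ g h x = count T g h x +
        if h ≤ g (Fin.last n) ∧ g (Fin.last n) ≤ x then 1 else 0 := by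
      unfold count
      rw [hT, Finset.sum_erase_add _ _ (Finset.mem_univ _)]
    rw [hadd]
    split_ifs <;> omega)
  have h1 := htrap.1 l hlh
  have h2 := htrap.2.1 (Fin.last n) (by omega)
  omega

theorem not_confluentFrom_startState {n k : ℕ} (hnk : Admissible n k) :
    ¬ CentralFiring.ConfluentFrom (FireIn Finset.univ) (startState n k) := by
  intro hconf
  obtain ⟨y, hy, hterm, hleft⟩ := exists_terminal_last_le n k (by
    obtain ⟨m, hm⟩ := hnk
    omega)
  obtain ⟨y', hy', htrap⟩ := exists_last_trapped n k hnk
  obtain ⟨z, hz, hz'⟩ := hconf y y' hy hy'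
  obtain ⟨l, hl⟩ := htrap z hz'
  rcases hz.cases_head with rfl | ⟨w, hw, -⟩
  · exact absurd (hleft l) (not_le.2 hl)
  · exact hterm w hw

/-! ### Mirror symmetry and passage to weights. -/

/-- Confluence is transported backwards along a relation that is a simulation in both directions
and functional. -/
theorem confluentFrom_of_simulation {X Y : Type*} {r : X → X → Prop} {s : Y → Y → Prop}
    {R : X → Y → Prop} (hrs : ∀ x x' y, R x y → r x x' → ∃ y', R x' y' ∧ s y y')
    (hsr : ∀ x y y', R x y → s y y' → ∃ x', R x' y' ∧ r x x')
    (hfun : ∀ x y y', R x y → R x y' → y = y') {x : X} {y : Y} (hxy : R x y)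
    (hx : CentralFiring.ConfluentFrom r x) : CentralFiring.ConfluentFrom s y := by
  have h1 : ∀ x x' y, R x y → ReflTransGen r x x' → ∃ y', R x' y' ∧ ReflTransGen s y y' := by
    intro x x' y hR h
    induction h with
    | refl => exact ⟨y, hR, .refl⟩
    | tail _ hb ih =>
      obtain ⟨y', hR', hy'⟩ := ih
      obtain ⟨y'', hR'', hy''⟩ := hrs _ _ _ hR' hb
      exact ⟨y'', hR'', hy'.tail hy''⟩
  have h2 : ∀ x y y', R x y → ReflTransGen s y y' → ∃ x', R x' y' ∧ ReflTransGen r x x' := by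
    intro x y y' hR h
    induction h with
    | refl => exact ⟨x, hR, .refl⟩
    | tail _ hb ih =>
      obtain ⟨x', hR', hx'⟩ := ih
      obtain ⟨x'', hR'', hx''⟩ := hsr _ _ _ hR' hb
      exact ⟨x'', hR'', hx'.tail hx''⟩
  intro a b ha hb
  obtain ⟨a', haR, ha'⟩ := h2 _ _ _ hxy ha
  obtain ⟨b', hbR, hb'⟩ := h2 _ _ _ hxy hb
  obtain ⟨z, hz, hz'⟩ := hx _ _ ha' hb'
  obtain ⟨u, hu, hu'⟩ := h1 _ _ _ haR hz
  obtain ⟨v, hv, hv'⟩ := h1 _ _ _ hbR hz'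
  obtain rfl := hfun _ _ _ hu hv
  exact ⟨u, hu', hv'⟩

/-- The mirror image of a state. -/
def mirror {n : ℕ} (f : Fin (n + 1) → ℤ) (i : Fin (n + 1)) : ℤ := 1 - f i.rev

theorem mirror_mirror {n : ℕ} (f : Fin (n + 1) → ℤ) : mirror (mirror f) = f := by
  funext i
  simp [mirror]

theorem FireIn.mirror {n : ℕ} {f f' : Fin (n + 1) → ℤ} (h : FireIn Finset.univ f f') :
    FireIn Finset.univ (mirror f) (mirror f') := by
  obtain ⟨i, -, j, -, hij, hf, rfl⟩ := h
  -- Reversing both labels and line swaps the roles of `i` and `j`.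
  refine ⟨j.rev, Finset.mem_univ _, i.rev, Finset.mem_univ _, Fin.rev_lt_rev.2 hij, ?_, ?_⟩
  · simp [ChipFiring.mirror, hf]
  · funext l
    simp only [ChipFiring.mirror, fire, Fin.rev_eq_iff (i := l)]
    split_ifs with h1 h2
    · exact absurd (Fin.rev_injective (h1.symm.trans h2)) hij.ne
    all_goals ring

theorem mirror_startState {n k : ℕ} (hk : k ≤ n + 1) :
    mirror (startState n k) = startState n (n + 1 - k) := by
  funext i
  have := i.isLt
  simp only [mirror, startState, Fin.val_rev]
  split_ifs <;> omega

theorem ConfluentFrom.mirror {n : ℕ} {f : Fin (n + 1) → ℤ}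
    (h : CentralFiring.ConfluentFrom (FireIn Finset.univ) f) :
    CentralFiring.ConfluentFrom (FireIn Finset.univ) (mirror f) := by
  refine confluentFrom_of_simulation (R := fun f g => g = ChipFiring.mirror f) ?_ ?_ ?_ rfl h
  · rintro x x' _ rfl hx
    exact ⟨_, rfl, hx.mirror⟩
  · rintro x _ y' rfl hy
    refine ⟨ChipFiring.mirror y', (mirror_mirror y').symm, ?_⟩
    simpa only [mirror_mirror] using hy.mirror
  · rintro x _ _ rfl rfl
    rfl

open CentralFiring in
theorem rootA_apply (n : ℕ) (i j l : Fin (n + 1)) :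
    (rootA n i j).1 l = (if l = i then (1 : ℝ) else 0) - if l = j then 1 else 0 := by
  simp [rootA]

/-- Central-firing in type `A_n` is labeled chip-firing on the line. -/
theorem confluentFrom_fireIn {n : ℕ} {c : ℝ}
    {ω : CentralFiring.weightLattice (CentralFiring.rootsA n)} {f : Fin (n + 1) → ℤ}
    (hω : ∀ i, ω.1.1 i = f i - c) (h : CentralFiring.ConfluentFrom (CentralFiring.FiresA n) ω) :
    CentralFiring.ConfluentFrom (FireIn Finset.univ) f := by
  have hroot : ∀ (w : CentralFiring.SpaceA n) (f : Fin (n + 1) → ℤ) (i j : Fin (n + 1)), i < j →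
      (∀ l, w.1 l = f l - c) →
      ∀ l, (w + CentralFiring.rootA n i j).1 l = fire i j f l - c := by
    intro w f i j hij hw l
    change w.1 l + (CentralFiring.rootA n i j).1 l = _
    rw [hw, rootA_apply, fire]
    by_cases h1 : l = i
    · subst h1
      simp [hij.ne]
      ring
    · by_cases h2 : l = j
      · subst h2
        simp [h1]
        ring
      · simp [h1, h2]
  refine confluentFrom_of_simulation (R := fun w f => ∀ i, w.1.1 i = (f i : ℝ) - c)
    ?_ ?_ ?_ hω h
  · rintro w w' f hR ⟨_, ⟨i, j, hij, rfl⟩, h0, hw'⟩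
    rw [CentralFiring.inner_coroot_rootA n _ hij.ne, hR, hR] at h0
    refine ⟨fire i j f, ?_, i, Finset.mem_univ _, j, Finset.mem_univ _, hij, ?_, rfl⟩
    · rw [hw']
      exact hroot _ _ _ _ hij hR
    · have : (f i : ℝ) = f j := by linarith
      exact_mod_cast this
  · rintro w f _ hR ⟨i, -, j, -, hij, hf, rfl⟩
    refine ⟨⟨w.1 + CentralFiring.rootA n i j, ?_⟩, hroot _ _ _ _ hij hR, _, ⟨i, j, hij, rfl⟩, ?_,
      rfl⟩
    · rintro _ ⟨a, b, hab, rfl⟩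
      refine ⟨fire i j f a - fire i j f b, ?_⟩
      rw [CentralFiring.inner_coroot_rootA n _ hab, hroot _ _ _ _ hij hR, hroot _ _ _ _ hij hR]
      push_cast
      ring
    · rw [CentralFiring.inner_coroot_rootA n _ hij.ne, hR, hR, hf]
      ring
  · intro w f f' hf hf'
    funext i
    have h1 := hf i
    have h2 := hf' i
    have : (f i : ℝ) = f' i := by linarith
    exact_mod_cast this

theorem coord_of_isFundWeightA {n k : ℕ} {ω : CentralFiring.SpaceA n}
    (h : CentralFiring.IsFundWeightA n k ω) :
    ∃ c : ℝ, ∀ i, ω.1 i = startState n k i - c := by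
  obtain ⟨i, rfl, hi⟩ := h
  -- Chip 0 starts at 1, as the label k is positive.
  refine ⟨1 - ω.1 0, fun l => ?_⟩
  induction l using Fin.induction with
  | zero => simp [startState]
  | succ l ih =>
    have h1 := hi l
    rw [CentralFiring.simpleRootA,
      CentralFiring.inner_coroot_rootA n ω (by simp [Fin.ext_iff])] at h1
    simp only [startState, Fin.val_castSucc, Fin.val_succ, Fin.ext_iff] at ih h1 ⊢
    split_ifs at ih h1 ⊢ <;> first | omega | (push_cast at *; linarith)

end ChipFiring

theorem mainTheorem6 (n : ℕ) (hn : 1 ≤ n)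
    (ω : CentralFiring.weightLattice (CentralFiring.rootsA n))
    (hω : (ω : CentralFiring.SpaceA n) = 0 ∨
      ∃ k : ℕ, 1 ≤ k ∧ k ≤ n ∧ CentralFiring.IsFundWeightA n k ω)
    (hexc : ¬ CentralFiring.IsExceptionalA n ω) :
    ¬ CentralFiring.ConfluentFrom (CentralFiring.FiresA n) ω := by
  intro hconf
  obtain ⟨k, hk, hadm, c, hc⟩ : ∃ k : ℕ, k ≤ n + 1 ∧
      (ChipFiring.Admissible n k ∨ ChipFiring.Admissible n (n + 1 - k)) ∧
      ∃ c : ℝ, ∀ i, ω.1.1 i = ChipFiring.startState n k i - c := by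
    rcases hω with h0 | ⟨k, hk1, hkn, hk⟩
    · refine ⟨0, by omega, Or.inl ?_, 0, fun i => by simp [h0, ChipFiring.startState]⟩
      rcases Nat.even_or_odd' n with ⟨m, hm | hm⟩
      · exact ⟨m, by omega⟩
      · exact absurd (Or.inl ⟨⟨m, hm⟩, Or.inl h0⟩) hexc
    · refine ⟨k, by omega, ?_, ChipFiring.coord_of_isFundWeightA hk⟩
      rcases Nat.even_or_odd' n with ⟨m, hm | hm⟩
      · have h1 : k ≠ n / 2 := fun e =>
          hexc (Or.inr ⟨⟨m, by omega⟩, Or.inl (e ▸ hk)⟩)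
        have h2 : k ≠ n / 2 + 1 := fun e =>
          hexc (Or.inr ⟨⟨m, by omega⟩, Or.inr (e ▸ hk)⟩)
        by_cases h : k < m
        · exact Or.inl ⟨m, by omega⟩
        · exact Or.inr ⟨m, by omega⟩
      · have h1 : k ≠ 1 := fun e =>
          hexc (Or.inl ⟨⟨m, hm⟩, Or.inr (Or.inl (e ▸ hk))⟩)
        have h2 : k ≠ n := fun e =>
          hexc (Or.inl ⟨⟨m, hm⟩, Or.inr (Or.inr (by rw [e] at hk; exact hk))⟩)
        -- Here n + 1 = 2(m + 1), so the `Admissible` witness is m + 1.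
        by_cases h : m + 1 ≤ k
        · exact Or.inl ⟨m + 1, by omega⟩
        · exact Or.inr ⟨m + 1, by omega⟩
  have hf := ChipFiring.confluentFrom_fireIn hc hconf
  rcases hadm with hadm | hadm
  · exact ChipFiring.not_confluentFrom_startState hadm hf
  · refine ChipFiring.not_confluentFrom_startState hadm ?_
    rw [← ChipFiring.mirror_startState hk]
    exact ChipFiring.ConfluentFrom.mirror hf
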